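/- Let $a,b,\tau$ be integers with $a\ge 1$, put $\delta=b-a$, and assume $\delta\ge a$ and $\tau+1\ge b+\delta$. Let $\mathbb F_q$ be any finite field with $q\ge\tau+1$ (so the required field size is linear in $\tau$). Put $k=\tau-a+1$ and $n=\tau+1+\delta=k+b$. Rows and columns of matrices are numbered from $0$, $[x:y]$ is the set of integers from $x$ to $y$, and $H(I,J)$ is the submatrix of $H$ with rows in $I$ and columns in $J$. **Construction.** Let $G$ be a zero-band generator matrix of a $[\tau+1,b]$ MDS code over $\mathbb F_q$, i.e. a generator matrix in which the zero entries of row $i$ are exactly those in columns $i+1,\dots,i+b-1$ modulo $\tau+1$. Let $C$ be an $a\times b$ matrix over $\mathbb F_q$ all of whose square submatrices are nonsingular (a Cauchy-like matrix). Such $G$ and $C$ exist. Define the $b\times n$ matrix $H$ by starting with the zero matrix and making, in this order, the updates 1. $H([0:b-1],[0:\tau])=G$; 2. $H([a:\delta],[\tau+a:\tau+\delta])=H([a:\delta],[a:\delta])$; 3. $H(b-j,\tau+j)=1$ for $1\le j\le a-1$; 4. $H([\delta:b-1],[0:b-1])=C$. **Theorem.** For every such $G$ and $C$, the code $\mathcal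 C=\{c\in\mathbb F_q^n: Hc=0\}$ has a systematic generator matrix $[I_k\ P]$, and the streaming code obtained by diagonally embedding $\mathcal C$ is rate-optimal for the delay-constrained sliding-window (DC-SW) channel with parameters $\{a,b,\tau,w=\tau+1\}$. Here the diagonally embedded code encodes message packets $s(t)=(s_0(t),\dots,s_{k-1}(t))\in\mathbb F_q^k$, $t=0,1,2,\dots$, into coded packets $x(t)=(s(t),p(t))\in\mathbb F_q^n$ with $$[p_0(t)\ p_1(t+1)\ \cdots\ p_{b-1}(t+b-1)]=[s_0(t-k)\ s_1(t-k+1)\ \cdots\ s_{k-1}(t-1)]\,P\qquad(t\in\mathbb Z),$$ where $s_j(t)=0$ for $t<0$. Rate-optimal means that: * the rate $k/n$ equals $\dfrac{\tau_{\rm eff}-a+1}{\tau_{\rm eff}+\delta+1}$ with $\tau_{\rm eff}=\min\{\tau,w-1\}$ (the known upper bound on the rate of streaming codes for this channel); and * there is a decoder, whose estimate of $s(t)$ is a function of the packets received (or seen to be erased) up to time $t+\tau$, that recovers every $s(t)$ correctly for every message stream and every erasure pattern in which, in each window of $w$ consecutive time slots, either the erasures are confined to a burst of at most $b$ consecutive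 slots or at most $a$ packets are erased. -/

import Mathlib

/-! ### MDS codes, zero-band generator matrices, Cauchy-like matrices -/

/-- A linear code of length `n` over `F` is an `[n, k]` MDS code: it has dimension `k` and minimum
Hamming distance at least (hence, by the Singleton bound, equal to) `n - k + 1`. -/
def IsMDSCode {F : Type*} [Field F] [DecidableEq F] {n : ℕ} (C : Submodule F (Fin n → F))
    (k : ℕ) : Prop :=
  Module.finrank F C = k ∧ ∀ c ∈ C, c ≠ 0 → n + 1 ≤ k + hammingNorm c

/-- `Z` is a zero-band generator matrix of the `[n, k]` MDS code `C`: its rows generate `C`, and the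
zero entries of row `i` are exactly the `k - 1` cyclically consecutive coordinates
`i + 1, …, i + k - 1` modulo `n`. -/
def IsZeroBandGenerator {F : Type*} [Field F] [DecidableEq F] {k n : ℕ}
    (Z : Matrix (Fin k) (Fin n) F) (C : Submodule F (Fin n → F)) : Prop :=
  IsMDSCode C k ∧
  Submodule.span F (Set.range fun i => Z i) = C ∧
  ∀ i j, Z i j = 0 ↔ ∃ m ∈ Finset.Icc 1 (k - 1), (j : ℕ) = ((i : ℕ) + m) % n

/-- A matrix is Cauchy-like if each of its square submatrices is nonsingular. -/
def IsCauchyLike {F : Type*} [Field F] {m n : ℕ} (A : Matrix (Fin m) (Fin n) F) : Prop :=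
  ∀ (s : ℕ) (f : Fin s ↪ Fin m) (g : Fin s ↪ Fin n), (A.submatrix f g).det ≠ 0

/-! ### Streaming codes and the sliding-window erasure channel -/

/-- A (systematic, causal) streaming encoder over `F`: at each time `t` a message packet
`s t ∈ F ^ k` arrives, and a parity packet in `F ^ r` is produced, which is a function of the message
packets up to time `t`. -/
structure StreamingCode (F : Type*) (k r : ℕ) where
  /-- the parity packet at time `t` for the message stream `s` -/
  parity : (ℕ → Fin k → F) → ℕ → Fin r → F
  causal : ∀ (s s' : ℕ → Fin k → F) (t : ℕ), (∀ u ≤ t, s u = s' u) → parity s t = parity s' t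

/-- The coded packet at time `t`: the message packet followed by the parity packet. -/
def StreamingCode.packet {F : Type*} {k r : ℕ} (S : StreamingCode F k r) (s : ℕ → Fin k → F)
    (t : ℕ) : Fin (k + r) → F :=
  Fin.append (s t) (S.parity s t)

/-- The rate of a streaming code that maps `k`-symbol message packets to `(k + r)`-symbol coded
packets. -/
def StreamingCode.rate {F : Type*} {k r : ℕ} (_S : StreamingCode F k r) : ℚ :=
  (k : ℚ) / ((k : ℚ) + (r : ℚ))

open Classical in
/-- The received stream when the packets with time index in `E` are erased (`none` is the erasure
symbol). -/
noncomputable def received {A : Type*} (E : Set ℕ) (x : ℕ → A) (t : ℕ) : Option A :=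
  if t ∈ E then none else some (x t)

/-- Erasure patterns of the sliding-window channel with parameters `a`, `b`, `w`: in every window of
`w` consecutive time slots, either the erasures form a burst of length at most `b` (they are confined
to `b` consecutive slots), or there are at most `a` of them. -/
def IsAdmissible (a b w : ℕ) (E : Set ℕ) : Prop :=
  ∀ i : ℕ, (∃ j : ℕ, E ∩ Set.Ico i (i + w) ⊆ Set.Ico j (j + b)) ∨
    (E ∩ Set.Ico i (i + w)).ncard ≤ a

/-- The code permits recovery from all erasure patterns of the sliding-window channel with
parameters `a`, `b`, `w`, with delay at most `τ`: some decoder, whose estimate of the message packet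
of time `t` depends only on what is received up to time `t + τ`, is always correct. -/
def StreamingCode.Recovers {F : Type*} {k r : ℕ} (S : StreamingCode F k r) (a b τ w : ℕ) : Prop :=
  ∃ D : (ℕ → Option (Fin (k + r) → F)) → ℕ → Fin k → F,
    (∀ y y' t, (∀ u ≤ t + τ, y u = y' u) → D y t = D y' t) ∧
    ∀ E : Set ℕ, IsAdmissible a b w E →
      ∀ (s : ℕ → Fin k → F) (t : ℕ), D (received E (S.packet s)) t = s t

/-- A streaming code is rate-optimal for the delay-constrained sliding-window channel with
parameters `a`, `b`, `τ`, `w` if its rate equals `(τ_eff - a + 1) / (τ_eff + δ + 1)`, where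
`τ_eff = min τ (w - 1)` and `δ = b - a`, and it recovers from all admissible erasure patterns. -/
def StreamingCode.IsRateOptimal {F : Type*} {k r : ℕ} (S : StreamingCode F k r)
    (a b τ w : ℕ) : Prop :=
  S.rate = (min (τ : ℚ) ((w : ℚ) - 1) - (a : ℚ) + 1) /
      (min (τ : ℚ) ((w : ℚ) - 1) + ((b : ℚ) - (a : ℚ)) + 1) ∧
    S.Recovers a b τ w

/-! ### Diagonal embedding of a block code -/

/-- The message packet at an integer time, with the convention that it vanishes at negative times. -/
def extendMessage {F : Type*} [Zero F] {k : ℕ} (s : ℕ → Fin k → F) (u : ℤ) : Fin k → F :=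
  if 0 ≤ u then s u.toNat else 0

/-- The diagonal embedding of the block code with systematic generator matrix `[I_k  P]`:
`[p_0(t) p_1(t+1) … p_{r-1}(t+r-1)] = [s_0(t-k) s_1(t-k+1) … s_{k-1}(t-1)] P` for all `t`. -/
def diagonalEmbedding {F : Type*} [Field F] {k r : ℕ} (P : Matrix (Fin k) (Fin r) F) :
    StreamingCode F k r where
  parity s t j := ∑ i : Fin k, extendMessage s ((t : ℤ) - (j : ℤ) - (k : ℤ) + (i : ℤ)) i * P i j
  causal := by
    intro s s' t h
    funext j
    refine Finset.sum_congr rfl fun i _ => ?_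
    have hi := i.isLt
    unfold extendMessage
    split_ifs with h0
    · rw [h _ (by omega)]
    · rfl

/-- `[I_k  P]` is a generator matrix of the code `C`. -/
def IsSystematicGenerator {F : Type*} [Field F] {k r : ℕ} (P : Matrix (Fin k) (Fin r) F)
    (C : Submodule F (Fin (k + r) → F)) : Prop :=
  Submodule.span F (Set.range fun i : Fin k => Fin.append ((1 : Matrix (Fin k) (Fin k) F) i) (P i))
    = C

/-- The code with parity-check matrix `H`. -/
def parityCheckCode {F : Type*} [Field F] {m n : ℕ} (H : Matrix (Fin m) (Fin n) F) :
    Submodule F (Fin n → F) :=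
  LinearMap.ker H.mulVecLin

/-! ### The parity-check matrix

It has `b` rows and `(τ + 1 - a) + b = τ + 1 + δ` columns, where `δ = b - a`, indexed from `0`.
-/

/-- Start from the zero matrix and set `H(:, 0:τ) = G`. -/
def constrStepA {F : Type*} [Field F] (a b τ : ℕ) (G : Matrix (Fin b) (Fin (τ + 1)) F) :
    Matrix (Fin b) (Fin (τ + 1 - a + b)) F :=
  fun i j => if h : (j : ℕ) < τ + 1 then G i ⟨j, h⟩ else 0

/-- Update `H` by setting `H(a:δ, τ+a:τ+δ) = H(a:δ, a:δ)`. -/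
def constrStepB {F : Type*} (a b τ : ℕ) (H : Matrix (Fin b) (Fin (τ + 1 - a + b)) F) :
    Matrix (Fin b) (Fin (τ + 1 - a + b)) F :=
  fun i j =>
    if a ≤ (i : ℕ) ∧ (i : ℕ) ≤ b - a ∧ τ + a ≤ (j : ℕ) ∧ (j : ℕ) ≤ τ + (b - a) then
      H i ⟨(j : ℕ) - τ, by omega⟩
    else H i j

/-- Update `H` by setting `H(b-m, τ+m) = 1` for `1 ≤ m ≤ a-1`
(here `m = j - τ` for a column index `j`). -/
def constrStepC {F : Type*} [Field F] (a b τ : ℕ) (H : Matrix (Fin b) (Fin (τ + 1 - a + b)) F) :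
    Matrix (Fin b) (Fin (τ + 1 - a + b)) F :=
  fun i j =>
    if τ + 1 ≤ (j : ℕ) ∧ (j : ℕ) ≤ τ + (a - 1) ∧ (i : ℕ) + ((j : ℕ) - τ) = b then 1 else H i j

/-- Update `H` by replacing `H(δ:b-1, 0:b-1)` with `C`. -/
def constrStepD {F : Type*} (a b τ : ℕ) (C : Matrix (Fin a) (Fin b) F)
    (H : Matrix (Fin b) (Fin (τ + 1 - a + b)) F) : Matrix (Fin b) (Fin (τ + 1 - a + b)) F :=
  fun i j =>
    if h : b - a ≤ (i : ℕ) ∧ (j : ℕ) < b then C ⟨(i : ℕ) - (b - a), by omega⟩ ⟨j, h.2⟩ else H i j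

/-- The parity-check matrix built from `G` and `C` by the four steps above. -/
def constructionB {F : Type*} [Field F] (a b τ : ℕ) (G : Matrix (Fin b) (Fin (τ + 1)) F)
    (C : Matrix (Fin a) (Fin b) F) : Matrix (Fin b) (Fin (τ + 1 - a + b)) F :=
  constrStepD a b τ C (constrStepC a b τ (constrStepB a b τ (constrStepA a b τ G)))

/-! ### Existence of the ingredients -/

/-! Write `d = b - a`. By linearity, decoding reduces to the block code. Suppose two streams agree
before time `t` and look alike up to time `t + τ`. Their difference along the diagonal through
symbol `j` of packet `t` is a codeword `x` that vanishes before `j` and at every unerased position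
up to `j + τ`; the task is to show `x j = 0`.

Two facts drive the argument. The first `m` rows of `G` vanish together on `[m, b)`, and by the MDS
property any `m` other columns of them are independent (`IsZeroBandGenerator.eq_zero`). Any rows of
`C` determine at most as many unknowns (`IsCauchyLike.eq_zero`).

Burst (`eq_zero_of_burst`): for `j < d`, row `j` suffices, because its `b - 1` zeros hide the rest
of the burst. For `j ≥ d` the whole codeword lies before the deadline, and the `b` consecutive
columns of the burst are independent (`eq_zero_of_consecutive`). The same lemma applied to the last
`b` columns gives the systematic form.

At most `a` erasures (`eq_zero_of_card_le`): the first `a` rows clear all columns up to `τ` outside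
`[a, b)`. For `j` in that gap, either row `j` alone gives `x j`, or every row of `C` that cannot be
used is charged to a nonzero symbol beyond column `τ`, so enough rows of `C` remain. -/

open Polynomial in
theorem isCauchyLike_inv_sub {F : Type*} [Field F] {m n : ℕ} (x : Fin m → F) (y : Fin n → F)
    (hx : Function.Injective x) (hy : Function.Injective y) (hxy : ∀ i j, x i ≠ y j) :
    IsCauchyLike (Matrix.of fun i j => (x i - y j)⁻¹) := by
  intro s f g hdet
  obtain ⟨v, hv, hMv⟩ := Matrix.exists_mulVec_eq_zero_iff.mpr hdet
  -- The numerator of `∑ v j / (X - y (g j))` over the common denominator: its degree is below `s`,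
  -- yet it has the `s` roots `x (f i)`.
  let Q : F[X] := ∑ j, C (v j) * ∏ l ∈ Finset.univ.erase j, (X - C (y (g l)))
  have hQdeg : Q.degree < s := by
    refine lt_of_le_of_lt (degree_sum_le _ _) ((Finset.sup_lt_iff (WithBot.bot_lt_coe _)).2 ?_)
    intro j _
    rw [← smul_eq_C_mul]
    refine lt_of_le_of_lt (degree_smul_le _ _) ?_
    rw [degree_prod, Finset.sum_congr rfl fun l _ => degree_X_sub_C _]
    simp only [Finset.sum_const, Finset.card_erase_of_mem (Finset.mem_univ j), Finset.card_univ,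
      Fintype.card_fin, nsmul_eq_mul, mul_one]
    have : 0 < s := j.pos
    exact_mod_cast (by omega : s - 1 < s)
  have hQ : Q = 0 := by
    refine eq_zero_of_degree_lt_of_eval_index_eq_zero Finset.univ (v := fun i => x (f i))
      (fun i _ j _ h => f.injective (hx h)) (by simpa using hQdeg) ?_
    intro i _
    have hi := congrFun hMv i
    simp only [Matrix.mulVec, dotProduct, Matrix.submatrix_apply, Matrix.of_apply,
      Pi.zero_apply] at hi
    have : Q.eval (x (f i)) =
        (∏ l, (x (f i) - y (g l))) * ∑ j, (x (f i) - y (g j))⁻¹ * v j := by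
      simp only [Q, eval_finsetSum, eval_mul, eval_C, eval_prod, eval_sub, eval_X,
        Finset.mul_sum]
      refine Finset.sum_congr rfl fun j _ => ?_
      rw [← Finset.mul_prod_erase _ _ (Finset.mem_univ j)]
      have := sub_ne_zero.2 (hxy (f i) (g j))
      field_simp
    rw [this, hi, mul_zero]
  refine hv (funext fun j => ?_)
  have hj : Q.eval (y (g j)) = 0 := by rw [hQ, eval_zero]
  simp only [Q, eval_finsetSum, eval_mul, eval_C, eval_prod, eval_sub, eval_X] at hj
  rw [Finset.sum_eq_single j] at hj
  · refine (mul_eq_zero.1 hj).resolve_right (Finset.prod_ne_zero_iff.2 fun l hl => ?_)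
    exact sub_ne_zero.2 fun h => Finset.ne_of_mem_erase hl (g.injective (hy h)).symm
  · intro l _ hl
    rw [Finset.prod_eq_zero (Finset.mem_erase.2 ⟨hl.symm, Finset.mem_univ j⟩) (sub_self _),
      mul_zero]
  · simp

theorem exists_isCauchyLike {F : Type*} [Field F] [Fintype F] (m n : ℕ)
    (h : m + n ≤ Fintype.card F) : ∃ A : Matrix (Fin m) (Fin n) F, IsCauchyLike A := by
  obtain ⟨e⟩ : Nonempty (Fin m ⊕ Fin n ↪ F) :=
    Function.Embedding.nonempty_of_card_le (by simpa using h)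
  exact ⟨_, isCauchyLike_inv_sub (fun i => e (.inl i)) (fun j => e (.inr j))
    (fun _ _ h => Sum.inl_injective (e.injective h)) (fun _ _ h => Sum.inr_injective (e.injective h))
    fun i j h => Sum.inl_ne_inr (e.injective h)⟩

/-- The leading square block of a matrix with the zero pattern of a zero-band generator is lower
triangular. -/
theorem linearIndependent_rows_of_band {F : Type*} [Field F] {k n : ℕ} (hkn : k ≤ n)
    (Z : Matrix (Fin k) (Fin n) F)
    (hZ : ∀ i j, Z i j = 0 ↔ ∃ m ∈ Finset.Icc 1 (k - 1), (j : ℕ) = ((i : ℕ) + m) % n) :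
    LinearIndependent F fun i => Z i := by
  let T : Matrix (Fin k) (Fin k) F := Z.submatrix id (Fin.castLE hkn)
  have hT : T.det ≠ 0 := by
    rw [Matrix.det_of_isLowerTriangular]
    · refine Finset.prod_ne_zero_iff.2 fun i _ h => ?_
      obtain ⟨m, hm, h⟩ := (hZ _ _).1 h
      rw [Finset.mem_Icc] at hm
      have := i.isLt
      simp only [Fin.val_castLE, id] at h
      rcases lt_or_ge ((i : ℕ) + m) n with h1 | h1
      · rw [Nat.mod_eq_of_lt h1] at h; omega
      · rw [Nat.mod_eq_sub_mod h1, Nat.mod_eq_of_lt (by omega)] at h; omega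
    · intro i j hij
      have hij : (i : ℕ) < j := hij
      have := j.isLt
      refine (hZ _ _).2 ⟨j - i, by rw [Finset.mem_Icc]; omega, ?_⟩
      simp only [Fin.val_castLE, id]
      rw [Nat.mod_eq_of_lt (by omega)]
      omega
  exact LinearIndependent.of_comp (LinearMap.funLeft F F (Fin.castLE hkn))
    (Matrix.linearIndependent_rows_of_det_ne_zero hT)

/-- A Reed–Solomon code on `n` distinct points: row `i` evaluates the polynomial of degree `k - 1`
whose roots are the points of its band. Codewords are evaluations of polynomials of degree at most
`k - 1`, which bounds their zeros. -/
theorem exists_isZeroBandGenerator {F : Type*} [Field F] [Fintype F] [DecidableEq F] (k n : ℕ)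
    (hk : 1 ≤ k) (hkn : k ≤ n) (hn : n ≤ Fintype.card F) :
    ∃ (C : Submodule F (Fin n → F)) (Z : Matrix (Fin k) (Fin n) F), IsZeroBandGenerator Z C := by
  obtain ⟨α⟩ : Nonempty (Fin n ↪ F) :=
    Function.Embedding.nonempty_of_card_le (by simpa using hn)
  have hn0 : 0 < n := by omega
  let p : Fin k → Polynomial F := fun i => ∏ m ∈ Finset.Icc 1 (k - 1),
    (Polynomial.X - Polynomial.C (α ⟨((i : ℕ) + m) % n, Nat.mod_lt _ hn0⟩))
  let Z : Matrix (Fin k) (Fin n) F := fun i j => (p i).eval (α j)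
  have hZ : ∀ i j, Z i j = 0 ↔ ∃ m ∈ Finset.Icc 1 (k - 1), (j : ℕ) = ((i : ℕ) + m) % n := by
    intro i j
    simp only [Z, p, Polynomial.eval_prod, Finset.prod_eq_zero_iff, Polynomial.eval_sub,
      Polynomial.eval_X, Polynomial.eval_C, sub_eq_zero, α.injective.eq_iff, Fin.ext_iff]
  refine ⟨_, Z, ⟨?_, ?_⟩, rfl, hZ⟩
  · rw [finrank_span_eq_card (linearIndependent_rows_of_band hkn Z hZ), Fintype.card_fin]
  · intro c hc hc0
    obtain ⟨y, rfl⟩ := (Submodule.mem_span_range_iff_exists_fun F).1 hc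
    let Q : Polynomial F := ∑ i, Polynomial.C (y i) * p i
    have hQ : ∀ j, Q.eval (α j) = (∑ i, y i • Z i) j := by
      intro j
      simp [Q, Z, Polynomial.eval_finsetSum, Finset.sum_apply]
    have hQ0 : Q ≠ 0 := by
      intro h
      refine hc0 (funext fun j => ?_)
      rw [← hQ, h]; simp
    have hdeg : Q.natDegree ≤ k - 1 := by
      refine Polynomial.natDegree_sum_le_of_forall_le _ _ fun i _ => ?_
      refine (Polynomial.natDegree_C_mul_le _ _).trans ?_
      refine (Polynomial.natDegree_prod_le _ _).trans ?_
      simp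
    have hroots : (Finset.univ.filter fun j => (∑ i, y i • Z i) j = 0).card ≤ k - 1 := by
      refine le_trans ?_ hdeg
      rw [← Finset.card_map α]
      refine Polynomial.card_le_degree_of_subset_roots fun r hr => ?_
      rw [Finset.mem_val, Finset.mem_map] at hr
      obtain ⟨j, hj, rfl⟩ := hr
      rw [Polynomial.mem_roots hQ0, Polynomial.IsRoot, hQ]
      exact (Finset.mem_filter.1 hj).2
    have := Finset.card_filter_add_card_filter_not (s := (Finset.univ : Finset (Fin n)))
      (fun j => (∑ i, y i • Z i) j = 0)
    rw [Finset.card_univ, Fintype.card_fin] at this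
    have h2 : hammingNorm (∑ i, y i • Z i) =
      (Finset.univ.filter fun j => ¬ (∑ i, y i • Z i) j = 0).card := rfl
    omega

/-! ### Extension by zero -/

/-- A matrix as a function of two natural numbers, extended by zero. -/
def extendMatrix {F : Type*} [Zero F] {m n : ℕ} (A : Matrix (Fin m) (Fin n) F) (i j : ℕ) : F :=
  if h : i < m ∧ j < n then A ⟨i, h.1⟩ ⟨j, h.2⟩ else 0

theorem extendMatrix_apply {F : Type*} [Zero F] {m n : ℕ} (A : Matrix (Fin m) (Fin n) F)
    {i j : ℕ} (hi : i < m) (hj : j < n) : extendMatrix A i j = A ⟨i, hi⟩ ⟨j, hj⟩ :=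
  dif_pos ⟨hi, hj⟩

/-! ### Kernels of square submatrices -/

theorem eq_zero_of_square_submatrix {F : Type*} [Field F] {s : ℕ} (A : ℕ → ℕ → F) (x : ℕ → F)
    (f : Fin s → ℕ) (T U : Finset ℕ) (hT : T.card = s) (hTU : T ⊆ U)
    (hdet : ∀ g : Fin s ↪ ℕ, (∀ l, g l ∈ T) → (Matrix.of fun i l => A (f i) (g l)).det ≠ 0)
    (hx : ∀ i, ∑ l ∈ U, A (f i) l * x l = 0) (hsupp : ∀ l ∈ U, l ∉ T → x l = 0) :
    ∀ l ∈ U, x l = 0 := by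
  intro l hl
  by_cases hlT : l ∈ T
  swap
  · exact hsupp l hl hlT
  let e := T.equivFinOfCardEq hT
  have h := Matrix.eq_zero_of_mulVec_eq_zero
    (hdet (e.symm.toEmbedding.trans (Function.Embedding.subtype _)) fun l => (e.symm l).2)
    (v := fun l => x (e.symm l)) (funext fun i => ?_)
  · have := congrFun h (e ⟨l, hlT⟩)
    simpa using this
  · rw [Pi.zero_apply, ← hx i, ← Finset.sum_subset hTU, ← Finset.sum_coe_sort T, ← e.symm.sum_comp]
    · rfl
    · intro l hl hlT
      rw [hsupp l hl hlT, mul_zero]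

/-- Surplus rows are discarded until the support of `x` gives a square submatrix. -/
theorem IsCauchyLike.eq_zero {F : Type*} [Field F] [DecidableEq F] {a b : ℕ}
    {C : Matrix (Fin a) (Fin b) F}
    (hC : IsCauchyLike C) (R : Finset ℕ) (hR : R ⊆ Finset.range a) (x : ℕ → F)
    (hx : ∀ r ∈ R, ∑ l ∈ Finset.range b, extendMatrix C r l * x l = 0)
    (hcard : ((Finset.range b).filter fun l => x l ≠ 0).card ≤ R.card) :
    ∀ l < b, x l = 0 := by
  obtain ⟨R', hR', hcard'⟩ := Finset.exists_subset_card_eq hcard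
  let f := R'.orderEmbOfFin hcard'
  have hf : ∀ i, f i ∈ R' := R'.orderEmbOfFin_mem hcard'
  have hfa : ∀ i, f i < a := fun i => Finset.mem_range.1 (hR (hR' (hf i)))
  have key := eq_zero_of_square_submatrix (extendMatrix C) x f _ (Finset.range b) rfl
    (Finset.filter_subset _ _) ?_ (fun i => hx _ (hR' (hf i))) ?_
  · exact fun l hl => key l (Finset.mem_range.2 hl)
  · intro g hg
    have hgb : ∀ l, g l < b := fun l =>
      Finset.mem_range.1 (Finset.mem_filter.1 (hg l)).1
    have := hC _ ⟨fun i => ⟨f i, hfa i⟩, fun i j h => f.injective (by simpa using h)⟩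
      ⟨fun l => ⟨g l, hgb l⟩, fun i j h => g.injective (by simpa using h)⟩
    convert this using 2
    ext i l
    exact extendMatrix_apply C (hfa i) (hgb l)
  · intro l hl hlT
    by_contra h
    exact hlT (Finset.mem_filter.2 ⟨hl, h⟩)

/-! ### Zero-band generator matrices -/

section ZeroBand

variable {F : Type*} [Field F] [DecidableEq F] {k n : ℕ} {Z : Matrix (Fin k) (Fin n) F}
  {C : Submodule F (Fin n → F)}

theorem IsZeroBandGenerator.band (hZ : IsZeroBandGenerator Z C) {i l : ℕ} (h1 : i < l)
    (h2 : l < i + k) : extendMatrix Z i l = 0 := by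
  unfold extendMatrix
  split_ifs with h
  · refine (hZ.2.2 _ _).2 ⟨l - i, by rw [Finset.mem_Icc]; omega, ?_⟩
    simp only
    rw [Nat.mod_eq_of_lt (by omega)]
    omega
  · rfl

theorem IsZeroBandGenerator.diag_ne_zero (hZ : IsZeroBandGenerator Z C) (hkn : k ≤ n) {i : ℕ}
    (hi : i < k) : extendMatrix Z i i ≠ 0 := by
  rw [extendMatrix_apply Z hi (hi.trans_le hkn)]
  intro h
  obtain ⟨m, hm, h⟩ := (hZ.2.2 _ _).1 h
  rw [Finset.mem_Icc] at hm
  simp only at h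
  rcases lt_or_ge (i + m) n with h1 | h1
  · rw [Nat.mod_eq_of_lt h1] at h; omega
  · rw [Nat.mod_eq_sub_mod h1, Nat.mod_eq_of_lt (by omega)] at h; omega

/-- The first `m` rows of a zero-band generator matrix have the common zeros `m, …, k - 1`; any `m`
further columns of them form a nonsingular matrix. -/
theorem IsZeroBandGenerator.eq_zero (hZ : IsZeroBandGenerator Z C) (hkn : k ≤ n) {m : ℕ}
    (hm : m ≤ k) (x : ℕ → F)
    (hx : ∀ i < m, ∑ l ∈ Finset.range n, extendMatrix Z i l * x l = 0)
    (hcard : ((Finset.range n).filter fun l => x l ≠ 0 ∧ ¬ (m ≤ l ∧ l < k)).card ≤ m) :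
    ∀ l < n, ¬ (m ≤ l ∧ l < k) → x l = 0 := by
  have hUcard : (Finset.range n \ Finset.Ico m k).card = n - (k - m) := by
    rw [Finset.card_sdiff_of_subset, Finset.card_range, Nat.card_Ico]
    intro l hl
    rw [Finset.mem_Ico] at hl
    rw [Finset.mem_range]
    omega
  obtain ⟨T, hST, hTU, hT⟩ := Finset.exists_subsuperset_card_eq
    (s := (Finset.range n).filter fun l => x l ≠ 0 ∧ ¬ (m ≤ l ∧ l < k))
    (t := Finset.range n \ Finset.Ico m k) (n := m)
    (by
      intro l hl
      simp only [Finset.mem_filter, Finset.mem_sdiff, Finset.mem_Ico] at hl ⊢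
      exact ⟨hl.1, hl.2.2⟩) hcard (by omega)
  have key := eq_zero_of_square_submatrix (extendMatrix Z) x (fun i : Fin m => (i : ℕ)) T
    (Finset.range n \ Finset.Ico m k) hT hTU ?_ ?_ ?_
  · intro l hl hlm
    exact key l (by rw [Finset.mem_sdiff, Finset.mem_range, Finset.mem_Ico]; exact ⟨hl, hlm⟩)
  · intro g hg hdet
    have hgn : ∀ l, g l < n := fun l =>
      Finset.mem_range.1 (Finset.mem_sdiff.1 (hTU (hg l))).1
    obtain ⟨y, hy, hyM⟩ := Matrix.exists_vecMul_eq_zero_iff.mpr hdet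
    -- This nonzero codeword vanishes on the `k - m` common zeros and on the `m` columns of `T`: `k`
    -- zeros, one more than the minimum distance allows.
    let c : Fin n → F := ∑ i : Fin m, y i • Z (Fin.castLE hm i)
    have hcC : c ∈ C := by
      rw [← hZ.2.1]
      exact Submodule.sum_mem _ fun i _ =>
        Submodule.smul_mem _ _ (Submodule.subset_span ⟨_, rfl⟩)
    have hc0 : c ≠ 0 := by
      intro h
      have hli := (linearIndependent_rows_of_band hkn Z hZ.2.2).comp (Fin.castLE hm)
        (Fin.castLE_injective hm)
      exact hy (funext fun i => Fintype.linearIndependent_iff.1 hli y h i)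
    have hw := hZ.1.2 c hcC hc0
    have hband : ∀ l : Fin n, m ≤ (l : ℕ) → (l : ℕ) < k → c l = 0 := by
      intro l h1 h2
      simp only [c, Finset.sum_apply, Pi.smul_apply, smul_eq_mul]
      refine Finset.sum_eq_zero fun i _ => ?_
      have hi := i.isLt
      have := hZ.band (i := i) (l := l) (by omega) (by omega)
      rw [extendMatrix_apply Z (by omega) l.2] at this
      rw [show Z (Fin.castLE hm i) l = 0 from this, mul_zero]
    have hcg : ∀ l, c ⟨g l, hgn l⟩ = 0 := by
      intro l
      have := congrFun hyM l
      simp only [Matrix.vecMul, dotProduct, Matrix.of_apply, Pi.zero_apply] at this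
      rw [← this]
      simp only [c, Finset.sum_apply, Pi.smul_apply, smul_eq_mul]
      refine Finset.sum_congr rfl fun i _ => ?_
      rw [extendMatrix_apply Z (i.2.trans_le hm) (hgn l)]
      rfl
    have hTg : ∀ l ∈ T, ∃ i, g i = l := by
      intro l hl
      have : Finset.univ.map g = T :=
        Finset.eq_of_subset_of_card_le
          (fun _ h => by obtain ⟨i, _, rfl⟩ := Finset.mem_map.1 h; exact hg i)
          (by simp [hT])
      rw [← this] at hl
      obtain ⟨i, _, h⟩ := Finset.mem_map.1 hl
      exact ⟨i, h⟩
    have hle : hammingNorm c ≤ ((Finset.range n \ Finset.Ico m k) \ T).card := by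
      rw [hammingNorm, ← Finset.card_map Fin.valEmbedding]
      refine Finset.card_le_card fun l hl => ?_
      obtain ⟨l, hlc, rfl⟩ := Finset.mem_map.1 hl
      have hl : c l ≠ 0 := (Finset.mem_filter.1 hlc).2
      simp only [Fin.valEmbedding_apply, Finset.mem_sdiff, Finset.mem_range, Finset.mem_Ico]
      refine ⟨⟨l.2, fun h => hl (hband l h.1 h.2)⟩, fun h => ?_⟩
      obtain ⟨i, hi⟩ := hTg l h
      exact hl (by rw [← hcg i]; exact congrArg c (Fin.ext hi.symm))
    rw [Finset.card_sdiff_of_subset hTU] at hle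
    omega
  · intro i
    rw [← hx i i.2]
    refine Finset.sum_subset Finset.sdiff_subset fun l hl hl' => ?_
    simp only [Finset.mem_sdiff, hl, Finset.mem_Ico, true_and, not_not] at hl'
    have := i.isLt
    rw [hZ.band (by omega) (by omega), zero_mul]
  · intro l hl hlT
    by_contra h
    rw [Finset.mem_sdiff, Finset.mem_Ico] at hl
    exact hlT (hST (Finset.mem_filter.2 ⟨hl.1, h, hl.2⟩))

end ZeroBand

/-! ### Solutions of the parity-check equations -/

/-- The equations `H x = 0` for the matrix `H` built from `G` and `C`, split according to the blocks
of rows `[0 : d - 1]`, `{d}` and `[d + 1 : b - 1]`, where `d = b - a`. -/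
structure SatisfiesParityChecks {F : Type*} [Field F] {a b τ : ℕ}
    (G : Matrix (Fin b) (Fin (τ + 1)) F) (C : Matrix (Fin a) (Fin b) F) (d : ℕ) (x : ℕ → F) :
    Prop where
  top : ∀ i < d, ∑ l ∈ Finset.range (τ + 1), extendMatrix G i l * x l +
    ∑ l ∈ Finset.Icc a d, extendMatrix G i l * x (τ + l) = 0
  mid : ∑ l ∈ Finset.range b, extendMatrix C 0 l * x l +
    ∑ l ∈ Finset.Ico b (τ + 1), extendMatrix G d l * x l +
    ∑ l ∈ Finset.Icc a d, extendMatrix G d l * x (τ + l) = 0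
  bot : ∀ i, d < i → i < b → ∑ l ∈ Finset.range b, extendMatrix C (i - d) l * x l +
    ∑ l ∈ Finset.Ico b (τ + 1), extendMatrix G i l * x l + x (τ + b - i) = 0

section Solutions

variable {F : Type*} [Field F] [DecidableEq F] {a b d τ : ℕ}
  {G : Matrix (Fin b) (Fin (τ + 1)) F} {C : Matrix (Fin a) (Fin b) F}
  {K : Submodule F (Fin (τ + 1) → F)} {x : ℕ → F}

/-- Any `b` consecutive columns of `H` that start at an index in `[d : τ + 1 - a]` are linearly
independent. -/
theorem SatisfiesParityChecks.eq_zero_of_consecutive (h : SatisfiesParityChecks G C d x)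
    (ha : 1 ≤ a) (hb : b = a + d) (had : a ≤ d) (hτ : b + d ≤ τ + 1)
    (hG : IsZeroBandGenerator G K) (hC : IsCauchyLike C) {j : ℕ} (hdj : d ≤ j)
    (hj : j + a ≤ τ + 1) (hx : ∀ l, x l ≠ 0 → j ≤ l ∧ l < j + b) : ∀ l, x l = 0 := by
  have hx0 : ∀ l, (l < j ∨ j + b ≤ l) → x l = 0 := fun l hl => by
    by_contra h0
    have := hx l h0
    omega
  -- The number of columns of the window beyond `τ` (truncated at zero). For `u < a` these are unit
  -- columns only, and the copied block of `G` plays no role.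
  obtain ⟨u, hu⟩ : ∃ u, u = j + b - (τ + 1) := ⟨_, rfl⟩
  rcases lt_or_ge u a with hua | hua
  · have hIcc : ∀ i, ∑ l ∈ Finset.Icc a d, extendMatrix G i l * x (τ + l) = 0 := fun i => by
      refine Finset.sum_eq_zero fun l hl => ?_
      rw [Finset.mem_Icc] at hl
      rw [hx0 (τ + l) (by omega), mul_zero]
    have hlow : ∀ l < b, x l = 0 := by
      rcases le_or_gt b j with hbj | hjb
      · exact fun l hl => hx0 l (by omega)
      -- These are the rows `j - u ≤ i < b - u` of `H`: they avoid the units in the window, and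
      -- their band covers the columns from `b` on that lie both in the window and up to `τ`. There
      -- are `b - j` of them, for the `b - j` unknowns of index below `b`.
      refine hC.eq_zero (Finset.Ico (j - u - d) (b - u - d)) ?_ x ?_ ?_
      · intro r hr
        rw [Finset.mem_Ico] at hr
        rw [Finset.mem_range]
        omega
      · intro r hr
        rw [Finset.mem_Ico] at hr
        have hIco : ∑ l ∈ Finset.Ico b (τ + 1), extendMatrix G (r + d) l * x l = 0 := by
          refine Finset.sum_eq_zero fun l hl => ?_
          rw [Finset.mem_Ico] at hl
          rcases lt_or_ge l (r + d + b) with h1 | h1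
          · rw [hG.band (by omega) h1, zero_mul]
          · rw [hx0 l (by omega), mul_zero]
        rcases Nat.eq_zero_or_pos r with rfl | hr0
        · have := h.mid
          rw [zero_add] at hIco
          rwa [hIcc, hIco, add_zero, add_zero] at this
        · have := h.bot (r + d) (by omega) (by omega)
          rwa [hIco, hx0 (τ + b - (r + d)) (by omega), add_zero, add_zero,
            Nat.add_sub_cancel] at this
      · refine (Finset.card_le_card (t := Finset.Ico j b) fun l hl => ?_).trans ?_
        · rw [Finset.mem_filter, Finset.mem_range] at hl
          have := hx l hl.2
          rw [Finset.mem_Ico]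
          omega
        · rw [Nat.card_Ico, Nat.card_Ico]
          omega
    have hC0 : ∀ r, ∑ l ∈ Finset.range b, extendMatrix C r l * x l = 0 := fun r =>
      Finset.sum_eq_zero fun l hl => by rw [hlow l (Finset.mem_range.1 hl), mul_zero]
    have hIco : ∀ i, ∑ l ∈ Finset.range (τ + 1), extendMatrix G i l * x l =
        ∑ l ∈ Finset.Ico b (τ + 1), extendMatrix G i l * x l := fun i => by
      rw [Finset.range_eq_Ico, ← Finset.sum_Ico_consecutive _ (Nat.zero_le b) (by omega),
        add_eq_right]
      exact Finset.sum_eq_zero fun l hl => by rw [hlow l (Finset.mem_Ico.1 hl).2, mul_zero]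
    have hmid : ∀ l < τ + 1, x l = 0 := by
      intro l hl
      by_cases hlb : b - u ≤ l ∧ l < b
      · exact hlow l hlb.2
      -- The last `u` rows contain the units; the `b - u` rows above them face at most `b - u`
      -- unknowns up to `τ`.
      refine hG.eq_zero (by omega) (m := b - u) (by omega) x ?_ ?_ l hl hlb
      · intro i hi
        rcases lt_trichotomy i d with h1 | rfl | h1
        · have := h.top i h1
          rwa [hIcc, add_zero] at this
        · have := h.mid
          rw [hIcc, hC0, zero_add, add_zero] at this
          rw [hIco, this]
        · have := h.bot i h1 (by omega)
          rw [hC0, zero_add, hx0 (τ + b - i) (by omega), add_zero] at this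
          rw [hIco, this]
      · refine (Finset.card_le_card (t := Finset.Ico j (min (τ + 1) (j + b)))
          fun l hl => ?_).trans ?_
        · rw [Finset.mem_filter, Finset.mem_range] at hl
          have := hx l hl.2.1
          rw [Finset.mem_Ico]
          omega
        · rw [Nat.card_Ico]
          omega
    intro l
    rcases lt_or_ge l (τ + 1) with h1 | h1
    · exact hmid l h1
    rcases lt_or_ge l (j + b) with h2 | h2
    · have := h.bot (τ + b - l) (by omega) (by omega)
      rw [hC0, ← hIco, Finset.sum_eq_zero, zero_add, zero_add] at this
      · rwa [show τ + b - (τ + b - l) = l by omega] at this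
      · exact fun l hl => by rw [hmid l (Finset.mem_range.1 hl), mul_zero]
    · exact hx0 l (Or.inr h2)
  · have hlow : ∀ l < b, x l = 0 := fun l hl => hx0 l (by omega)
    have hC0 : ∀ r, ∑ l ∈ Finset.range b, extendMatrix C r l * x l = 0 := fun r =>
      Finset.sum_eq_zero fun l hl => by rw [hlow l (Finset.mem_range.1 hl), mul_zero]
    -- Here `j ≥ b`, so the first `b` columns are free. Since columns `τ + a, …, τ + d` copy columns
    -- `a, …, d` of `G`, moving their symbols back to `[a, d]` turns the equations of rows `0, …, d`
    -- into equations for `G` alone.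
    let y : ℕ → F := fun l => if b ≤ l then x l else if a ≤ l ∧ l ≤ d then x (τ + l) else 0
    have hy : ∀ l < τ + 1, ¬ (d + 1 ≤ l ∧ l < b) → y l = 0 := by
      refine hG.eq_zero (by omega) (m := d + 1) (by omega) y ?_ ?_
      · intro i hi
        have hsplit : ∑ l ∈ Finset.range (τ + 1), extendMatrix G i l * y l =
            ∑ l ∈ Finset.Ico b (τ + 1), extendMatrix G i l * x l +
              ∑ l ∈ Finset.Icc a d, extendMatrix G i l * x (τ + l) := by
          rw [Finset.range_eq_Ico, ← Finset.sum_Ico_consecutive _ (Nat.zero_le b) (by omega),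
            add_comm]
          congr 1
          · refine Finset.sum_congr rfl fun l hl => ?_
            rw [show y l = x l from if_pos (Finset.mem_Ico.1 hl).1]
          · symm
            refine (Finset.sum_congr rfl fun l hl => ?_).trans (Finset.sum_subset
              (f := fun l => extendMatrix G i l * y l) (fun l hl => ?_) fun l hl hl' => ?_)
            · rw [Finset.mem_Icc] at hl
              simp only [y]
              rw [if_neg (by omega), if_pos hl]
            · rw [Finset.mem_Icc] at hl
              rw [Finset.mem_Ico]
              omega
            · rw [Finset.mem_Ico] at hl
              rw [Finset.mem_Icc] at hl'
              simp only [y]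
              rw [if_neg (by omega), if_neg hl', mul_zero]
        rw [hsplit]
        rcases lt_or_ge i d with h1 | h1
        · have := h.top i h1
          rw [Finset.range_eq_Ico, ← Finset.sum_Ico_consecutive _ (Nat.zero_le b) (by omega),
            Finset.sum_eq_zero (s := Finset.Ico 0 b), zero_add] at this
          · exact this
          · exact fun l hl => by rw [hlow l (Finset.mem_Ico.1 hl).2, mul_zero]
        · obtain rfl : i = d := by omega
          have := h.mid
          rwa [hC0, zero_add] at this
      -- The unknowns are `τ + 1 - j` in place and `j + b - τ - a` moved ones, `d + 1` in total,
      -- matching the number of rows.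
      · refine (Finset.card_le_card
          (t := Finset.Ico j (τ + 1) ∪ Finset.Icc a (j + b - 1 - τ)) fun l hl => ?_).trans
          ((Finset.card_union_le _ _).trans ?_)
        · rw [Finset.mem_filter, Finset.mem_range] at hl
          rw [Finset.mem_union, Finset.mem_Ico, Finset.mem_Icc]
          have h0 := hl.2.1
          simp only [y] at h0
          split_ifs at h0 with h1 h2
          · have := hx l h0
            omega
          · have := hx _ h0
            omega
          · exact absurd rfl h0
        · rw [Nat.card_Ico, Nat.card_Icc]
          omega
    have hmid : ∀ l < τ + 1, x l = 0 := by
      intro l hl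
      rcases lt_or_ge l b with h1 | h1
      · exact hlow l h1
      · have := hy l hl (by omega)
        simp only [y] at this
        rwa [if_pos h1] at this
    intro l
    rcases lt_or_ge l (τ + 1) with h1 | h1
    · exact hmid l h1
    rcases lt_or_ge l (τ + a) with h2 | h2
    · have := h.bot (τ + b - l) (by omega) (by omega)
      rw [hC0, Finset.sum_eq_zero, zero_add, zero_add] at this
      · rwa [show τ + b - (τ + b - l) = l by omega] at this
      · exact fun l hl => by rw [hmid l (Finset.mem_Ico.1 hl).2, mul_zero]
    rcases lt_or_ge l (j + b) with h3 | h3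
    · have := hy (l - τ) (by omega) (by omega)
      simp only [y] at this
      rwa [if_neg (by omega), if_pos (by omega), show τ + (l - τ) = l by omega] at this
    · exact hx0 l (Or.inr h3)

/-- The symbol at which a burst of length at most `b` starts is determined with delay `τ`. -/
theorem SatisfiesParityChecks.eq_zero_of_burst (h : SatisfiesParityChecks G C d x)
    (ha : 1 ≤ a) (hb : b = a + d) (had : a ≤ d) (hτ : b + d ≤ τ + 1)
    (hG : IsZeroBandGenerator G K) (hC : IsCauchyLike C) {j : ℕ} (hj : j + a ≤ τ + 1)
    (hlt : ∀ l < j, x l = 0) (hn : ∀ l, τ + d < l → x l = 0)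
    (hx : ∀ l, j + b ≤ l → l ≤ j + τ → x l = 0) : x j = 0 := by
  rcases lt_or_ge j d with hjd | hjd
  · have hrow := h.top j hjd
    rw [Finset.sum_eq_single j, Finset.sum_eq_zero, add_zero] at hrow
    · exact (mul_eq_zero.1 hrow).resolve_left (hG.diag_ne_zero (by omega) (by omega))
    · intro l hl
      rw [Finset.mem_Icc] at hl
      rcases lt_or_ge j l with h1 | h1
      · rw [hG.band h1 (by omega), zero_mul]
      · rw [hx (τ + l) (by omega) (by omega), mul_zero]
    · intro l hl hlj
      rw [Finset.mem_range] at hl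
      rcases lt_or_ge l j with h1 | h1
      · rw [hlt l h1, mul_zero]
      rcases lt_or_ge l (j + b) with h2 | h2
      · rw [hG.band (by omega) h2, zero_mul]
      · rw [hx l h2 (by omega), mul_zero]
    · intro hj'
      rw [Finset.mem_range] at hj'
      omega
  -- Now `j + τ ≥ τ + d`, the last index of a codeword, so nothing lies past the deadline.
  · refine h.eq_zero_of_consecutive ha hb had hτ hG hC hjd hj (fun l hl => ?_) j
    by_contra hcon
    refine hl ?_
    rcases lt_or_ge l j with h1 | h1
    · exact hlt l h1
    rcases le_or_gt l (j + τ) with h2 | h2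
    · exact hx l (by omega) h2
    · exact hn l (by omega)

/-- The first of at most `a` erased symbols is determined with delay `τ`. -/
theorem SatisfiesParityChecks.eq_zero_of_card_le (h : SatisfiesParityChecks G C d x)
    (ha : 1 ≤ a) (hb : b = a + d) (had : a ≤ d) (hτ : b + d ≤ τ + 1)
    (hG : IsZeroBandGenerator G K) (hC : IsCauchyLike C) {j : ℕ} (hj : j + a ≤ τ)
    (hlt : ∀ l < j, x l = 0) (S : Finset ℕ)
    (hS : ∀ l, l ≤ j + τ → l ≤ τ + d → x l ≠ 0 → l ∈ S) (hcard : S.card ≤ a) : x j = 0 := by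
  -- In rows `i < a` the band kills the copied columns `[a, d]`, leaving `a` equations of `G` alone
  -- for at most `a` unknowns.
  have hmid : ∀ l < τ + 1, ¬ (a ≤ l ∧ l < b) → x l = 0 := by
    refine hG.eq_zero (by omega) (by omega) x ?_ ?_
    · intro i hi
      have := h.top i (by omega)
      rwa [Finset.sum_eq_zero (s := Finset.Icc a d), add_zero] at this
      intro l hl
      rw [Finset.mem_Icc] at hl
      rw [hG.band (by omega) (by omega), zero_mul]
    · refine (Finset.card_le_card fun l hl => ?_).trans hcard
      rw [Finset.mem_filter, Finset.mem_range] at hl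
      exact hS l (by omega) (by omega) hl.2.1
  by_cases hjb : a ≤ j ∧ j < b
  swap
  · exact hmid j (by omega) hjb
  have hIco : ∀ i, ∑ l ∈ Finset.Ico b (τ + 1), extendMatrix G i l * x l = 0 := fun i =>
    Finset.sum_eq_zero fun l hl => by
      rw [Finset.mem_Ico] at hl
      rw [hmid l hl.2 (by omega), mul_zero]
  -- The remaining unknowns in `[j, b)` fall in the band of row `i`, so only the copied block
  -- contributes; it is lower triangular with nonzero diagonal.
  have htri : ∀ i, a ≤ i → i < j → i < d → x (τ + i) = 0 := by
    intro i
    induction i using Nat.strong_induction_on with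
    | _ i ih =>
      intro hai hij hid
      have hrow := h.top i hid
      rw [Finset.sum_eq_zero, zero_add, Finset.sum_eq_single i] at hrow
      · exact (mul_eq_zero.1 hrow).resolve_left (hG.diag_ne_zero (by omega) (by omega))
      · intro l hl hli
        rw [Finset.mem_Icc] at hl
        rcases lt_or_ge l i with h1 | h1
        · rw [ih l h1 hl.1 (by omega) (by omega), mul_zero]
        · rw [hG.band (by omega) (by omega), zero_mul]
      · exact fun hi => absurd (Finset.mem_Icc.2 ⟨hai, hid.le⟩) hi
      · intro l hl
        rw [Finset.mem_range] at hl
        rcases lt_or_ge l j with h1 | h1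
        · rw [hlt l h1, mul_zero]
        rcases lt_or_ge l b with h2 | h2
        · rw [hG.band (by omega) (by omega), zero_mul]
        · rw [hmid l hl (by omega), mul_zero]
  obtain ⟨e, he⟩ : ∃ e, e = min j d := ⟨_, rfl⟩
  have hdiag : ∑ l ∈ Finset.Icc a d, extendMatrix G e l * x (τ + l) =
      extendMatrix G e e * x (τ + e) := by
    refine Finset.sum_eq_single e (fun l hl hle => ?_) fun h1 =>
      absurd (Finset.mem_Icc.2 (by omega)) h1
    rw [Finset.mem_Icc] at hl
    rcases lt_or_ge l e with h1 | h1
    · rw [htri l hl.1 (by omega) (by omega), mul_zero]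
    · rw [hG.band (by omega) (by omega), zero_mul]
  by_cases hjd : j < d ∧ x (τ + j) = 0
  · obtain rfl : e = j := by omega
    have hrow := h.top e hjd.1
    rw [hdiag, hjd.2, mul_zero, add_zero, Finset.sum_eq_single e] at hrow
    · exact (mul_eq_zero.1 hrow).resolve_left (hG.diag_ne_zero (by omega) (by omega))
    · intro l hl hle
      rw [Finset.mem_range] at hl
      rcases lt_or_ge l e with h1 | h1
      · rw [hlt l h1, mul_zero]
      rcases lt_or_ge l b with h2 | h2
      · rw [hG.band (by omega) (by omega), zero_mul]
      · rw [hmid l hl (by omega), mul_zero]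
    · intro h1
      rw [Finset.mem_range] at h1
      omega
  -- The symbol charged for row `r` of `C`: for `r > 0`, the one at the unit of row `d + r`; for `r
  -- = 0` and `j ≥ d`, the last symbol `x (τ + d)`. If `j < d`, then `x (τ + j) ≠ 0` is charged
  -- instead and row `0` is not used.
  let p : ℕ → ℕ := fun r => if r = 0 then τ + e else τ + a - r
  have hp : Set.InjOn p (Finset.range a) := by
    intro r hr s hs hrs
    simp only [Finset.coe_range, Set.mem_Iio] at hr hs
    simp only [p] at hrs
    split_ifs at hrs <;> omega
  refine hC.eq_zero ((Finset.range a).filter fun r => x (p r) = 0) (Finset.filter_subset _ _) x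
    ?_ ?_ j hjb.2
  · intro r hr
    rw [Finset.mem_filter, Finset.mem_range] at hr
    obtain ⟨hra, hr⟩ := hr
    simp only [p] at hr
    split_ifs at hr with hr0
    · subst hr0
      obtain rfl : e = d := by
        by_contra hed
        obtain rfl : e = j := by omega
        exact hjd ⟨by omega, hr⟩
      have := h.mid
      rwa [hIco, hdiag, hr, mul_zero, add_zero, add_zero] at this
    · have := h.bot (r + d) (by omega) (by omega)
      rwa [hIco, show τ + b - (r + d) = τ + a - r by omega, hr, add_zero, add_zero,
        Nat.add_sub_cancel] at this
  · have hsum := Finset.card_filter_add_card_filter_not (s := Finset.range a)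
      (fun r => x (p r) = 0)
    rw [Finset.card_range] at hsum
    -- The charged symbols are distinct, lie beyond `τ` and before the deadline `j + τ`. With the
    -- nonzero symbols below `b` they number at most `a`, so the latter are no more than the usable
    -- rows.
    have hdisj : Disjoint ((Finset.range b).filter fun l => x l ≠ 0)
        (((Finset.range a).filter fun r => ¬ x (p r) = 0).image p) := by
      rw [Finset.disjoint_left]
      intro l hl hl'
      rw [Finset.mem_filter, Finset.mem_range] at hl
      obtain ⟨r, hr, rfl⟩ := Finset.mem_image.1 hl'
      rw [Finset.mem_filter, Finset.mem_range] at hr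
      have h1 := hl.1
      simp only [p] at h1
      split_ifs at h1 <;> omega
    have hle := Finset.card_union_of_disjoint hdisj
    rw [Finset.card_image_of_injOn
      (hp.mono (Finset.coe_subset.2 (Finset.filter_subset _ _)))] at hle
    have hsub := Finset.card_le_card (Finset.union_subset
      (s := (Finset.range b).filter fun l => x l ≠ 0)
      (t := ((Finset.range a).filter fun r => ¬ x (p r) = 0).image p) (u := S)
      (fun l hl => ?_) fun l hl => ?_)
    · omega
    · rw [Finset.mem_filter, Finset.mem_range] at hl
      exact hS l (by omega) (by omega) hl.2
    · obtain ⟨r, hr, rfl⟩ := Finset.mem_image.1 hl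
      rw [Finset.mem_filter, Finset.mem_range] at hr
      refine hS _ ?_ ?_ hr.2 <;> simp only [p] <;> split_ifs <;> omega

end Solutions

/-! ### The rows of the parity-check matrix -/

/-- A vector as a function of a natural number, extended by zero. -/
def extendVector {F : Type*} [Zero F] {n : ℕ} (c : Fin n → F) (l : ℕ) : F :=
  if h : l < n then c ⟨l, h⟩ else 0

theorem extendVector_apply {F : Type*} [Zero F] {n : ℕ} (c : Fin n → F) (l : Fin n) :
    extendVector c l = c l :=
  dif_pos l.2

theorem extendVector_of_le {F : Type*} [Zero F] {n : ℕ} (c : Fin n → F) {l : ℕ} (h : n ≤ l) :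
    extendVector c l = 0 :=
  dif_neg (not_lt.2 h)

theorem mulVec_eq_sum_range {F : Type*} [Field F] {m n : ℕ} (A : Matrix (Fin m) (Fin n) F)
    (c : Fin n → F) {i : ℕ} (hi : i < m) : A.mulVec c ⟨i, hi⟩ =
      ∑ l ∈ Finset.range n, extendMatrix A i l * extendVector c l := by
  simp only [Matrix.mulVec, dotProduct]
  rw [Finset.sum_range fun l => extendMatrix A i l * extendVector c l]
  refine Finset.sum_congr rfl fun l _ => ?_
  rw [extendMatrix_apply A hi l.2, extendVector_apply]

section Construction

variable {F : Type*} [Field F] {a b τ : ℕ} (G : Matrix (Fin b) (Fin (τ + 1)) F)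
  (C : Matrix (Fin a) (Fin b) F)

theorem extendMatrix_constructionB_of_lt (ha : 1 ≤ a) (hδ : a ≤ b - a)
    {i l : ℕ} (hi : i < b) (hl : l < τ + 1) (h : i < b - a ∨ b ≤ l) :
    extendMatrix (constructionB a b τ G C) i l = extendMatrix G i l := by
  rw [extendMatrix_apply _ hi (by omega), extendMatrix_apply _ hi hl]
  simp only [constructionB, constrStepD, constrStepC, constrStepB, constrStepA]
  rw [dif_neg (by omega), if_neg (by omega), if_neg (by omega), dif_pos hl]

theorem extendMatrix_constructionB_of_lower_left {i l : ℕ}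
    (hi : i < b) (hl : l < b) (h : b - a ≤ i) (hab : a ≤ b) :
    extendMatrix (constructionB a b τ G C) i l = extendMatrix C (i - (b - a)) l := by
  rw [extendMatrix_apply _ hi (by omega), extendMatrix_apply _ (by omega) hl]
  simp only [constructionB, constrStepD]
  rw [dif_pos ⟨h, hl⟩]

theorem extendMatrix_constructionB_right (hδ : a ≤ b - a) (hτ : b + (b - a) ≤ τ + 1)
    {i l : ℕ} (hi : i < b) (hl1 : 1 ≤ l) (hl : l ≤ b - a) :
    extendMatrix (constructionB a b τ G C) i (τ + l) =
      if a ≤ i ∧ i ≤ b - a ∧ a ≤ l then extendMatrix G i l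
      else if l < a ∧ i + l = b then 1 else 0 := by
  rw [extendMatrix_apply _ hi (by omega), extendMatrix_apply _ hi (by omega)]
  simp only [constructionB, constrStepD, constrStepC, constrStepB, constrStepA]
  rw [dif_neg (by omega)]
  by_cases h1 : l < a ∧ i + l = b
  · rw [if_pos (by omega), if_neg (by omega), if_pos h1]
  · rw [if_neg (by omega), if_neg h1]
    by_cases h2 : a ≤ i ∧ i ≤ b - a ∧ a ≤ l
    · rw [if_pos (by omega), if_pos h2, dif_pos (by omega)]
      congr 2
      omega
    · rw [if_neg (by omega), if_neg h2, dif_neg (by omega)]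

theorem satisfiesParityChecks_extendVector [DecidableEq F] {K : Submodule F (Fin (τ + 1) → F)}
    (ha : 1 ≤ a) (hδ : a ≤ b - a) (hτ : b + (b - a) ≤ τ + 1) (hG : IsZeroBandGenerator G K)
    {c : Fin (τ + 1 - a + b) → F} (hc : c ∈ parityCheckCode (constructionB a b τ G C)) :
    SatisfiesParityChecks G C (b - a) (extendVector c) := by
  have hrow : ∀ i, i < b →
      ∑ l ∈ Finset.Ico 0 b,
        extendMatrix (constructionB a b τ G C) i l * extendVector c l +
      ∑ l ∈ Finset.Ico b (τ + 1),
        extendMatrix (constructionB a b τ G C) i l * extendVector c l +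
      (∑ l ∈ Finset.Ico 1 a,
        extendMatrix (constructionB a b τ G C) i (τ + l) * extendVector c (τ + l) +
      ∑ l ∈ Finset.Icc a (b - a),
        extendMatrix (constructionB a b τ G C) i (τ + l) * extendVector c (τ + l)) = 0 := by
    intro i hi
    have h0 : (constructionB a b τ G C).mulVec c = 0 := LinearMap.mem_ker.1 hc
    have h := congrFun h0 ⟨i, hi⟩
    rw [mulVec_eq_sum_range] at h
    rw [Finset.sum_Ico_consecutive _ (Nat.zero_le b) (by omega),
      ← Finset.Ico_add_one_right_eq_Icc, Finset.sum_Ico_consecutive _ ha (by omega),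
      Finset.sum_Ico_add
        (fun l => extendMatrix (constructionB a b τ G C) i l * extendVector c l),
      add_comm 1 τ, Finset.sum_Ico_consecutive _ (by omega) (by omega), ← Finset.range_eq_Ico]
    rwa [show b - a + 1 + τ = τ + 1 - a + b by omega]
  refine ⟨fun i hi => ?_, ?_, fun i h1 h2 => ?_⟩
  · rw [← hrow i (by omega), Finset.range_eq_Ico,
      ← Finset.sum_Ico_consecutive _ (Nat.zero_le b) (by omega)]
    congr 1
    · congr 1 <;> refine Finset.sum_congr rfl fun l hl => ?_ <;> rw [Finset.mem_Ico] at hl <;>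
        rw [extendMatrix_constructionB_of_lt G C ha hδ (by omega) (by omega) (by omega)]
    · rw [Finset.sum_eq_zero (s := Finset.Ico 1 a), zero_add]
      · refine Finset.sum_congr rfl fun l hl => ?_
        rw [Finset.mem_Icc] at hl
        rw [extendMatrix_constructionB_right G C hδ hτ (by omega) (by omega) (by omega)]
        split_ifs with h1 h2
        · rfl
        · omega
        -- The copied block starts at row `a`, but for `i < a` the band makes the added terms zero,
        -- so all rows `i < d` share one formula.
        · rw [hG.band (by omega) (by omega)]
      · intro l hl
        rw [Finset.mem_Ico] at hl
        rw [extendMatrix_constructionB_right G C hδ hτ (by omega) (by omega) (by omega),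
          if_neg (by omega), if_neg (by omega), zero_mul]
  · rw [← hrow (b - a) (by omega), Finset.range_eq_Ico]
    congr 1
    · congr 1 <;> refine Finset.sum_congr rfl fun l hl => ?_ <;> rw [Finset.mem_Ico] at hl
      · rw [extendMatrix_constructionB_of_lower_left G C (by omega) hl.2 le_rfl (by omega),
          Nat.sub_self]
      · rw [extendMatrix_constructionB_of_lt G C ha hδ (by omega) (by omega) (by omega)]
    · rw [Finset.sum_eq_zero (s := Finset.Ico 1 a), zero_add]
      · refine Finset.sum_congr rfl fun l hl => ?_
        rw [Finset.mem_Icc] at hl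
        rw [extendMatrix_constructionB_right G C hδ hτ (by omega) (by omega) (by omega),
          if_pos (by omega)]
      · intro l hl
        rw [Finset.mem_Ico] at hl
        rw [extendMatrix_constructionB_right G C hδ hτ (by omega) (by omega) (by omega),
          if_neg (by omega), if_neg (by omega), zero_mul]
  · rw [← hrow i h2, Finset.range_eq_Ico]
    congr 1
    · congr 1 <;> refine Finset.sum_congr rfl fun l hl => ?_ <;> rw [Finset.mem_Ico] at hl
      · rw [extendMatrix_constructionB_of_lower_left G C (by omega) hl.2 (by omega) (by omega)]
      · rw [extendMatrix_constructionB_of_lt G C ha hδ (by omega) (by omega) (by omega)]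
    · rw [Finset.sum_eq_zero (s := Finset.Icc a (b - a)), add_zero,
        Finset.sum_eq_single (b - i)]
      · rw [extendMatrix_constructionB_right G C hδ hτ (by omega) (by omega) (by omega),
          if_neg (by omega), if_pos (by omega), one_mul,
          show τ + b - i = τ + (b - i) by omega]
      · intro l hl hli
        rw [Finset.mem_Ico] at hl
        rw [extendMatrix_constructionB_right G C hδ hτ (by omega) (by omega) (by omega),
          if_neg (by omega), if_neg (by omega), zero_mul]
      · intro h
        rw [Finset.mem_Ico] at h
        omega
      · intro l hl
        rw [Finset.mem_Icc] at hl
        rw [extendMatrix_constructionB_right G C hδ hτ (by omega) (by omega) (by omega),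
          if_neg (by omega), if_neg (by omega), zero_mul]

end Construction

/-! ### Systematic generator matrices -/

/-- The hypothesis makes the last `r` columns of `H = [A M]` invertible, so the parity symbols are
`-M⁻¹ A` applied to the message. -/
theorem exists_isSystematicGenerator {F : Type*} [Field F] {k r : ℕ}
    (H : Matrix (Fin r) (Fin (k + r)) F)
    (hH : ∀ c ∈ parityCheckCode H, (∀ i : Fin k, c (Fin.castAdd r i) = 0) → c = 0) :
    ∃ P : Matrix (Fin k) (Fin r) F, IsSystematicGenerator P (parityCheckCode H) := by
  have hsplit : ∀ (u : Fin k → F) (v : Fin r → F), H.mulVec (Fin.append u v) =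
      (H.submatrix id (Fin.castAdd r)).mulVec u + (H.submatrix id (Fin.natAdd k)).mulVec v := by
    intro u v
    funext i
    simp [Matrix.mulVec, dotProduct, Fin.sum_univ_add]
  have hM : IsUnit (H.submatrix id (Fin.natAdd k)) := by
    rw [← Matrix.mulVec_injective_iff_isUnit, ← Matrix.coe_mulVecLin,
      injective_iff_map_eq_zero]
    intro v hv
    have h0 := hH (Fin.append 0 v) (LinearMap.mem_ker.2 ?_) (by simp)
    · funext l
      simpa using congrFun h0 (Fin.natAdd k l)
    · rw [Matrix.mulVecLin_apply] at hv ⊢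
      rw [hsplit, hv, Matrix.mulVec_zero, add_zero]
  have hdet := (Matrix.isUnit_iff_isUnit_det _).1 hM
  let P : Matrix (Fin k) (Fin r) F := (-((H.submatrix id (Fin.natAdd k))⁻¹ *
    H.submatrix id (Fin.castAdd r))).transpose
  have hP : ∀ i, Fin.append ((1 : Matrix (Fin k) (Fin k) F) i) (P i) ∈ parityCheckCode H := by
    intro i
    refine LinearMap.mem_ker.2 ?_
    have hone : (1 : Matrix (Fin k) (Fin k) F) i = Pi.single i 1 := by
      funext l
      simp [Matrix.one_apply, Pi.single_apply, eq_comm]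
    have h1 : (H.submatrix id (Fin.natAdd k)).mulVec (P i) =
        - (H.submatrix id (Fin.castAdd r)).mulVec (Pi.single i 1) := by
      have : P i = (-((H.submatrix id (Fin.natAdd k))⁻¹ *
          H.submatrix id (Fin.castAdd r))).mulVec (Pi.single i 1) := by
        rw [Matrix.mulVec_single_one]
        rfl
      rw [this, Matrix.mulVec_mulVec, Matrix.mul_neg,
        Matrix.mul_nonsing_inv_cancel_left _ _ hdet, Matrix.neg_mulVec]
    rw [Matrix.mulVecLin_apply, hsplit, hone, h1, add_neg_cancel]
  refine ⟨P, le_antisymm (Submodule.span_le.2 ?_) fun c hc => ?_⟩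
  · rintro _ ⟨i, rfl⟩
    exact hP i
  · have hw : ∑ i, c (Fin.castAdd r i) •
        Fin.append ((1 : Matrix (Fin k) (Fin k) F) i) (P i) ∈ parityCheckCode H :=
      Submodule.sum_mem _ fun i _ => Submodule.smul_mem _ _ (hP i)
    have h0 := hH _ (Submodule.sub_mem _ hc hw) fun i => by
      simp [Finset.sum_apply, Matrix.one_apply]
    rw [sub_eq_zero.1 h0]
    exact Submodule.sum_mem _ fun i _ => Submodule.smul_mem _ _ (Submodule.subset_span ⟨i, rfl⟩)

theorem IsSystematicGenerator.append_mem {F : Type*} [Field F] {k r : ℕ}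
    {P : Matrix (Fin k) (Fin r) F} {C : Submodule F (Fin (k + r) → F)}
    (hP : IsSystematicGenerator P C) (u : Fin k → F) :
    Fin.append u (fun j => ∑ i, u i * P i j) ∈ C := by
  have : Fin.append u (fun j => ∑ i, u i * P i j) =
      ∑ i, u i • Fin.append ((1 : Matrix (Fin k) (Fin k) F) i) (P i) := by
    funext l
    refine Fin.addCases (fun l => ?_) (fun l => ?_) l <;>
      simp [Finset.sum_apply, Matrix.one_apply]
  rw [this, ← hP]
  exact Submodule.sum_mem _ fun i _ => Submodule.smul_mem _ _ (Submodule.subset_span ⟨i, rfl⟩)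

/-! ### Decoding -/

/-- A decoder exists as soon as the message packet of time `t` is determined by the earlier message
packets and the packets received up to time `t + τ`. -/
theorem StreamingCode.recovers_of_forall_eq {F : Type*} [Zero F] {k r : ℕ}
    (S : StreamingCode F k r) (a b τ w : ℕ)
    (h : ∀ E : Set ℕ, IsAdmissible a b w E → ∀ (s s' : ℕ → Fin k → F) (t : ℕ),
      (∀ u < t, s u = s' u) → (∀ u ≤ t + τ, u ∉ E → S.packet s u = S.packet s' u) → s t = s' t) :
    S.Recovers a b τ w := by
  -- The decoder picks any admissible pattern and stream consistent with what is seen up to `t + τ`.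
  -- The choice depends on the predicate alone, hence only on those packets.
  let Q : (ℕ → Option (Fin (k + r) → F)) → ℕ → Set ℕ × (ℕ → Fin k → F) → Prop :=
    fun y t p => IsAdmissible a b w p.1 ∧ ∀ u ≤ t + τ, received p.1 (S.packet p.2) u = y u
  refine ⟨fun y t => (Classical.epsilon (Q y t)).2 t, ?_, ?_⟩
  · intro y y' t hy
    have : Q y t = Q y' t := by
      funext p
      refine propext (and_congr_right fun _ => forall₂_congr fun u hu => ?_)
      rw [hy u hu]
    beta_reduce
    rw [this]
  · intro E hE s t
    beta_reduce
    obtain ⟨hE', hs'⟩ : Q (received E (S.packet s)) t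
        (Classical.epsilon (Q (received E (S.packet s)) t)) :=
      Classical.epsilon_spec (p := Q (received E (S.packet s)) t) ⟨(E, s), hE, fun _ _ => rfl⟩
    generalize Classical.epsilon (Q (received E (S.packet s)) t) = p at hE' hs'
    -- The guess is consistent up to `t + τ ≥ v + τ`, so the hypothesis, applied to the guessed
    -- pattern, recovers the packets one after another.
    have key : ∀ v, v ≤ t → p.2 v = s v := by
      intro v
      induction v using Nat.strong_induction_on with
      | _ v ih =>
        intro hv
        refine h p.1 hE' _ _ v (fun u hu => ih u hu (by omega)) fun u hu hup => ?_
        have hu' := hs' u (by omega)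
        unfold received at hu'
        rw [if_neg hup] at hu'
        split_ifs at hu' with huE
        exact Option.some_injective _ hu'
    exact key t le_rfl

/-- A codeword of the block code read off along a diagonal of the difference of two coded streams. -/
theorem exists_mem_diagonal {F : Type*} [Field F] {k r : ℕ} {P : Matrix (Fin k) (Fin r) F}
    {C : Submodule F (Fin (k + r) → F)} (hP : IsSystematicGenerator P C)
    (s s' : ℕ → Fin k → F) (t : ℕ) (j : Fin k) (hs : ∀ u < t, s u = s' u) :
    ∃ c ∈ C, (∀ l < (j : ℕ), extendVector c l = 0) ∧
      ∀ l : Fin (k + r), (j : ℕ) ≤ l →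
        c l = (diagonalEmbedding P).packet s (t + (l - j)) l -
          (diagonalEmbedding P).packet s' (t + (l - j)) l := by
  let u : Fin k → F := fun i => extendMessage s ((t : ℤ) - (j : ℕ) + (i : ℕ)) i -
    extendMessage s' ((t : ℤ) - (j : ℕ) + (i : ℕ)) i
  refine ⟨_, hP.append_mem u, fun l hl => ?_, fun l => ?_⟩
  · have hlk : l < k := hl.trans j.2
    have : extendVector (Fin.append u fun j => ∑ i, u i * P i j) l = u ⟨l, hlk⟩ := by
      rw [← Fin.append_left u (fun j => ∑ i, u i * P i j)]
      exact extendVector_apply _ (Fin.castAdd r ⟨l, hlk⟩)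
    rw [this]
    simp only [u, extendMessage]
    split_ifs with h0
    · rw [hs _ (by omega), sub_self]
    · exact sub_self _
  · refine Fin.addCases (fun i => ?_) (fun i => ?_) l
    · intro hji
      rw [Fin.val_castAdd] at hji
      simp only [StreamingCode.packet, Fin.append_left, Fin.val_castAdd, u, extendMessage]
      rw [if_pos (by omega), if_pos (by omega),
        show ((t : ℤ) - (j : ℕ) + (i : ℕ)).toNat = t + (i - j) by omega]
    · intro hji
      rw [Fin.val_natAdd] at hji
      simp only [StreamingCode.packet, Fin.append_right, Fin.val_natAdd, diagonalEmbedding]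
      rw [← Finset.sum_sub_distrib]
      refine Finset.sum_congr rfl fun m _ => ?_
      rw [← sub_mul]
      have := j.2
      simp only [u]
      rw [show ((t + (k + (i : ℕ) - j) : ℕ) : ℤ) - (i : ℕ) - (k : ℤ) + (m : ℕ) =
        (t : ℤ) - (j : ℕ) + (m : ℕ) by omega]

theorem diagonalEmbedding_recovers {F : Type*} [Field F] [DecidableEq F] {a b τ : ℕ}
    (ha : 1 ≤ a) (hδ : a ≤ b - a) (hτ : b + (b - a) ≤ τ + 1)
    {G : Matrix (Fin b) (Fin (τ + 1)) F} {C : Matrix (Fin a) (Fin b) F}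
    {K : Submodule F (Fin (τ + 1) → F)} (hG : IsZeroBandGenerator G K) (hC : IsCauchyLike C)
    {P : Matrix (Fin (τ + 1 - a)) (Fin b) F}
    (hP : IsSystematicGenerator P (parityCheckCode (constructionB a b τ G C))) :
    (diagonalEmbedding P).Recovers a b τ (τ + 1) := by
  refine StreamingCode.recovers_of_forall_eq _ a b τ (τ + 1) fun E hE s s' t hs hr => ?_
  by_cases htE : t ∈ E
  swap
  · funext j
    have := congrFun (hr t (by omega) htE) (Fin.castAdd b j)
    simpa [StreamingCode.packet] using this
  funext j
  have hjk := j.2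
  obtain ⟨c, hc, hlt, hcj⟩ := exists_mem_diagonal hP s s' t j hs
  have hpc := satisfiesParityChecks_extendVector G C ha hδ hτ hG hc
  -- Position `l` of the diagonal is sent at time `t + (l - j)`, so the deadline `t + τ` is position
  -- `j + τ`.
  have hvis : ∀ l, (j : ℕ) ≤ l → l ≤ j + τ → t + (l - j) ∉ E → extendVector c l = 0 := by
    intro l h1 h2 h3
    rcases lt_or_ge l (τ + 1 - a + b) with h4 | h4
    · rw [extendVector_apply c ⟨l, h4⟩, hcj _ h1, hr _ (by omega) h3, sub_self]
    · exact extendVector_of_le c h4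
  have hzero : extendVector c j = 0 := by
    -- The window `[t, t + τ]` starts at an erased slot, so a burst covering its erasures lies in
    -- `[t, t + b)`.
    rcases hE t with ⟨i, hi⟩ | hcard
    · have hit := hi ⟨htE, by simp⟩
      rw [Set.mem_Ico] at hit
      refine hpc.eq_zero_of_burst ha (by omega) hδ hτ hG hC (by omega) hlt
        (fun l hl => extendVector_of_le c (by omega)) fun l h1 h2 => hvis l (by omega) h2 ?_
      intro hmem
      have := hi ⟨hmem, by rw [Set.mem_Ico]; omega⟩
      rw [Set.mem_Ico] at this
      omega
    · have hfin : (E ∩ Set.Ico t (t + (τ + 1))).Finite :=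
        (Set.finite_Ico _ _).subset Set.inter_subset_right
      rw [Set.ncard_eq_toFinset_card _ hfin] at hcard
      refine hpc.eq_zero_of_card_le ha (by omega) hδ hτ hG hC (by omega) hlt
        (hfin.toFinset.image fun v => v - t + j) (fun l h1 _ h3 => ?_)
        (Finset.card_image_le.trans hcard)
      have hjl : (j : ℕ) ≤ l := by
        by_contra h4
        exact h3 (hlt l (by omega))
      refine Finset.mem_image.2 ⟨t + (l - j), ?_, by omega⟩
      rw [Set.Finite.mem_toFinset]
      refine ⟨?_, by rw [Set.mem_Ico]; omega⟩
      by_contra h4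
      exact h3 (hvis l hjl h1 h4)
  have hj := hcj (Fin.castAdd b j) (by simp)
  rw [← extendVector_apply c (Fin.castAdd b j), Fin.val_castAdd, hzero, Nat.sub_self,
    add_zero] at hj
  simp only [StreamingCode.packet, Fin.append_left] at hj
  exact (sub_eq_zero.1 hj.symm)

theorem theorem2 {F : Type*} [Field F] [Fintype F] [DecidableEq F] (a b τ : ℕ)
    (ha : 1 ≤ a) (hδ : a ≤ b - a) (hτ : b + (b - a) ≤ τ + 1) (hq : τ + 1 ≤ Fintype.card F) :
    -- the ingredients of the construction exist over `F`
    (∃ (CMDS : Submodule F (Fin (τ + 1) → F)) (G : Matrix (Fin b) (Fin (τ + 1)) F),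
      IsZeroBandGenerator G CMDS) ∧
    (∃ C : Matrix (Fin a) (Fin b) F, IsCauchyLike C) ∧
    -- and every choice of them yields a rate-optimal streaming code by diagonal embedding
    ∀ (CMDS : Submodule F (Fin (τ + 1) → F)) (G : Matrix (Fin b) (Fin (τ + 1)) F)
      (C : Matrix (Fin a) (Fin b) F),
      IsZeroBandGenerator G CMDS → IsCauchyLike C →
        (∃ P : Matrix (Fin (τ + 1 - a)) (Fin b) F,
          IsSystematicGenerator P (parityCheckCode (constructionB a b τ G C))) ∧
        ∀ P : Matrix (Fin (τ + 1 - a)) (Fin b) F,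
          IsSystematicGenerator P (parityCheckCode (constructionB a b τ G C)) →
            (diagonalEmbedding P).IsRateOptimal a b τ (τ + 1) := by
  refine ⟨exists_isZeroBandGenerator b (τ + 1) (by omega) (by omega) hq,
    exists_isCauchyLike a b (by omega), fun CMDS G C hG hC => ⟨?_, fun P hP => ⟨?_, ?_⟩⟩⟩
  · refine exists_isSystematicGenerator _ fun c hc hc0 => ?_
    have hpc := satisfiesParityChecks_extendVector G C ha hδ hτ hG hc
    -- The largest admissible starting index: these are the last `b` columns of `H`, the parity
    -- positions.
    have h := hpc.eq_zero_of_consecutive ha (by omega) hδ hτ hG hC (j := τ + 1 - a) (by omega)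
      (by omega) fun l hl => ?_
    · funext l
      rw [← extendVector_apply c l, h l, Pi.zero_apply]
    · by_contra hcon
      refine hl ?_
      rcases lt_or_ge l (τ + 1 - a) with h1 | h1
      · rw [← hc0 ⟨l, h1⟩, ← extendVector_apply c]
        rfl
      · exact extendVector_of_le c (by omega)
  · have hcast : ((τ + 1 - a : ℕ) : ℚ) = (τ : ℚ) + 1 - a := by
      rw [Nat.cast_sub (by omega)]
      push_cast
      ring
    rw [StreamingCode.rate, hcast, Nat.cast_add, Nat.cast_one, add_sub_cancel_right, min_self]
    congr 1 <;> ring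
  · exact diagonalEmbedding_recovers ha hδ hτ hG hC hP
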